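/- Let $K$ be an arbitrary field and let $E=(E^0,E^1,s,r)$ be a row-finite directed graph, i.e. $s^{-1}(x)$ is finite for every vertex $x\in E^0$. No cardinality assumption is made on $E^0$ and $E^1$; loops and parallel edges are allowed. The Leavitt path algebra $L_K(E)$ is the associative, not necessarily unital, $K$-algebra generated by $\{x \mid x\in E^0\}\cup\{e,e^*\mid e\in E^1\}$ subject to the relations: (V) $xy=\delta_{x,y}x$ for all $x,y\in E^0$; (E1) $s(e)e=e\,r(e)=e$ for all $e\in E^1$; (E2) $r(e)e^*=e^*s(e)=e^*$ for all $e\in E^1$; (CK1) $e^*f=\delta_{e,f}\,r(e)$ for all $e,f\in E^1$; (CK2) $x=\sum_{e\in s^{-1}(x)}ee^*$ for every $x\in E^0$ that is not a sink (a sink is a vertex $x$ with $s^{-1}(x)=\emptyset$). Shift move: suppose that $v\neq w$ are vertices of a graph $E$, neither of them a sink, and that $\theta:s^{-1}(w)\to s^{-1}(v)$ is an injective map with $r(\theta(g))=r(g)$ for all $g\in s^{-1}(w)$. The corresponding shift of $E$ is the graph with the same vertex set $E^0$ and with edge set $\bigl(E^1\setminus\theta(s^{-1}(w))\bigr)\cup\{f_{v,w}\}$,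 where $f_{v,w}\notin E^1$ is a new edge with $s(f_{v,w})=v$ and $r(f_{v,w})=w$, and where all the other edges keep their source and range. Theorem. If $F$ is a graph that is obtained, up to isomorphism of graphs, from the row-finite graph $E$ by finitely many successive shift moves, then $L_K(E)$ and $L_K(F)$ are isomorphic as $K$-algebras. -/

import Mathlib

universe u v u' v' k

/-- A directed graph `(E⁰, E¹, s, r)`: loops and parallel edges are allowed, and nothing is
assumed about cardinalities. -/
structure DirectedGraph where
  Vertex : Type u
  Edge : Type v
  source : Edge → Vertex
  range : Edge → Vertex

namespace DirectedGraph

/-- The set `s⁻¹(x)` of edges emitted by the vertex `x`. -/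
def emitted (E : DirectedGraph.{u, v}) (x : E.Vertex) : Set E.Edge := {e | E.source e = x}

/-- A graph is row-finite if every vertex emits finitely many edges. -/
def RowFinite (E : DirectedGraph.{u, v}) : Prop := ∀ x : E.Vertex, (E.emitted x).Finite

/-- A sink is a vertex which emits no edge. -/
def IsSink (E : DirectedGraph.{u, v}) (x : E.Vertex) : Prop := E.emitted x = ∅

/-- Isomorphisms of directed graphs. -/
structure Iso (E : DirectedGraph.{u, v}) (F : DirectedGraph.{u', v'}) where
  onVertex : E.Vertex ≃ F.Vertex
  onEdge : E.Edge ≃ F.Edge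
  source_onEdge : ∀ e : E.Edge, F.source (onEdge e) = onVertex (E.source e)
  range_onEdge : ∀ e : E.Edge, F.range (onEdge e) = onVertex (E.range e)

/-- The graph with the vertices of `E` whose edges are those of `E` outside the image of
`θ : s⁻¹(w) → s⁻¹(v)`, together with one new edge (written `none`) from `v` to `w`. -/
def shift (E : DirectedGraph.{u, v}) (v w : E.Vertex) (θ : E.emitted w → E.emitted v) :
    DirectedGraph.{u, v} where
  Vertex := E.Vertex
  Edge := Option {e : E.Edge // ∀ g : E.emitted w, (θ g : E.Edge) ≠ e}
  source := fun f => f.elim v (fun e => E.source e)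
  range := fun f => f.elim w (fun e => E.range e)

/-- `F` is (up to an isomorphism of graphs) obtained from `E` by one shift move: there are
distinct vertices `v`, `w`, neither of them a sink, and an injective map
`θ : s⁻¹(w) → s⁻¹(v)` which preserves ranges, such that `F` is the corresponding shift of `E`. -/
def IsShiftMove (E F : DirectedGraph.{u, v}) : Prop :=
  ∃ (v w : E.Vertex) (θ : E.emitted w → E.emitted v),
    v ≠ w ∧ ¬ E.IsSink v ∧ ¬ E.IsSink w ∧ Function.Injective θ ∧
    (∀ g : E.emitted w, E.range (θ g) = E.range g) ∧
    Nonempty (Iso (E.shift v w θ) F)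

/-- `F` is obtained from `E` by finitely many (possibly zero) successive shift moves, up to an
isomorphism of graphs. -/
def ObtainedByShiftMoves (E : DirectedGraph.{u, v}) (F : DirectedGraph.{u', v'}) : Prop :=
  ∃ G : DirectedGraph.{u, v}, Relation.ReflTransGen IsShiftMove E G ∧ Nonempty (Iso G F)

end DirectedGraph

/-- The generators of the Leavitt path algebra: the vertices, the edges and the ghost edges. -/
inductive LeavittGen (E : DirectedGraph.{u, v}) : Type (max u v)
  | vertex : E.Vertex → LeavittGen E
  | edge : E.Edge → LeavittGen E
  | ghost : E.Edge → LeavittGen E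

/-- The free associative (not necessarily unital) `K`-algebra on the generators: the semigroup
algebra of the free semigroup. -/
abbrev LeavittFree (K : Type k) [Field K] (E : DirectedGraph.{u, v}) : Type (max u v k) :=
  MonoidAlgebra K (FreeSemigroup (LeavittGen E))

namespace LeavittFree

variable (K : Type k) [Field K] (E : DirectedGraph.{u, v})

/-- A generator as an element of the free algebra. -/
noncomputable def gen (x : LeavittGen E) : LeavittFree K E :=
  MonoidAlgebra.single (FreeSemigroup.of x) 1

/-- The generator of a vertex. -/
noncomputable def vert (x : E.Vertex) : LeavittFree K E := gen K E (.vertex x)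

/-- The generator `e` of an edge. -/
noncomputable def edge (e : E.Edge) : LeavittFree K E := gen K E (.edge e)

/-- The generator `e*` of a ghost edge. -/
noncomputable def ghost (e : E.Edge) : LeavittFree K E := gen K E (.ghost e)

/-- The congruence of `K`-algebras generated by the defining relations (V), (E1), (E2), (CK1)
and (CK2). -/
inductive Rel : LeavittFree K E → LeavittFree K E → Prop
  | vert_same (x : E.Vertex) : Rel (vert K E x * vert K E x) (vert K E x)
  | vert_ne (x y : E.Vertex) : x ≠ y → Rel (vert K E x * vert K E y) 0
  | source_edge (e : E.Edge) : Rel (vert K E (E.source e) * edge K E e) (edge K E e)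
  | edge_range (e : E.Edge) : Rel (edge K E e * vert K E (E.range e)) (edge K E e)
  | range_ghost (e : E.Edge) : Rel (vert K E (E.range e) * ghost K E e) (ghost K E e)
  | ghost_source (e : E.Edge) : Rel (ghost K E e * vert K E (E.source e)) (ghost K E e)
  | ck1_same (e : E.Edge) : Rel (ghost K E e * edge K E e) (vert K E (E.range e))
  | ck1_ne (e f : E.Edge) : e ≠ f → Rel (ghost K E e * edge K E f) 0
  | ck2 (x : E.Vertex) (hfin : (E.emitted x).Finite) : ¬ E.IsSink x →
      Rel (vert K E x) (∑ e ∈ hfin.toFinset, edge K E e * ghost K E e)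
  | refl (a) : Rel a a
  | symm {a b} : Rel a b → Rel b a
  | trans {a b c} : Rel a b → Rel b c → Rel a c
  | add {a b c d} : Rel a b → Rel c d → Rel (a + c) (b + d)
  | mul {a b c d} : Rel a b → Rel c d → Rel (a * c) (b * d)
  | smul (t : K) {a b} : Rel a b → Rel (t • a) (t • b)

/-- The congruence as a setoid. -/
def setoid : Setoid (LeavittFree K E) := ⟨Rel K E, Rel.refl, Rel.symm, Rel.trans⟩

end LeavittFree

/-- The Leavitt path algebra `L_K(E)`: the associative, not necessarily unital `K`-algebra
generated by vertices, edges and ghost edges subject to (V), (E1), (E2), (CK1) and (CK2). -/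
def LeavittPathAlgebra (K : Type k) [Field K] (E : DirectedGraph.{u, v}) : Type (max u v k) :=
  Quotient (LeavittFree.setoid K E)

namespace LeavittPathAlgebra

open LeavittFree

variable (K : Type k) [Field K] (E : DirectedGraph.{u, v})

/-- The quotient map from the free algebra. -/
def mk (a : LeavittFree K E) : LeavittPathAlgebra K E := Quotient.mk (LeavittFree.setoid K E) a

theorem mk_surjective : Function.Surjective (mk K E) := Quotient.mk_surjective

theorem Rel.neg {a b : LeavittFree K E} (h : Rel K E a b) : Rel K E (-a) (-b) := by
  simpa using h.smul (-1 : K)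

theorem Rel.sub {a b c d : LeavittFree K E} (h : Rel K E a b) (h' : Rel K E c d) :
    Rel K E (a - c) (b - d) := by
  simpa [sub_eq_add_neg] using h.add (Rel.neg K E h')

theorem Rel.nsmul (n : ℕ) {a b : LeavittFree K E} (h : Rel K E a b) :
    Rel K E (n • a) (n • b) := by
  simpa only [Nat.cast_smul_eq_nsmul] using h.smul (n : K)

theorem Rel.zsmul (n : ℤ) {a b : LeavittFree K E} (h : Rel K E a b) :
    Rel K E (n • a) (n • b) := by
  simpa only [Int.cast_smul_eq_zsmul] using h.smul (n : K)

noncomputable instance : Zero (LeavittPathAlgebra K E) := ⟨mk K E 0⟩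

noncomputable instance : Add (LeavittPathAlgebra K E) :=
  ⟨Quotient.map₂ (· + ·) fun _ _ h _ _ h' => Rel.add h h'⟩

noncomputable instance : Mul (LeavittPathAlgebra K E) :=
  ⟨Quotient.map₂ (· * ·) fun _ _ h _ _ h' => Rel.mul h h'⟩

noncomputable instance : Neg (LeavittPathAlgebra K E) :=
  ⟨Quotient.map (- ·) fun _ _ h => Rel.neg K E h⟩

noncomputable instance : Sub (LeavittPathAlgebra K E) :=
  ⟨Quotient.map₂ (· - ·) fun _ _ h _ _ h' => Rel.sub K E h h'⟩

noncomputable instance : SMul ℕ (LeavittPathAlgebra K E) :=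
  ⟨fun n => Quotient.map (n • ·) fun _ _ h => Rel.nsmul K E n h⟩

noncomputable instance : SMul ℤ (LeavittPathAlgebra K E) :=
  ⟨fun n => Quotient.map (n • ·) fun _ _ h => Rel.zsmul K E n h⟩

noncomputable instance : SMul K (LeavittPathAlgebra K E) :=
  ⟨fun t => Quotient.map (t • ·) fun _ _ h => Rel.smul t h⟩

noncomputable instance : NonUnitalRing (LeavittPathAlgebra K E) :=
  (mk_surjective K E).nonUnitalRing (mk K E) rfl (fun _ _ => rfl) (fun _ _ => rfl)
    (fun _ => rfl) (fun _ _ => rfl) (fun _ _ => rfl) (fun _ _ => rfl)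

/-- The quotient map as a homomorphism of additive groups. -/
noncomputable def mkAddHom : LeavittFree K E →+ LeavittPathAlgebra K E where
  toFun := mk K E
  map_zero' := rfl
  map_add' := fun _ _ => rfl

noncomputable instance : Module K (LeavittPathAlgebra K E) :=
  (mk_surjective K E).module K (mkAddHom K E) (fun _ _ => rfl)

instance : IsScalarTower K (LeavittPathAlgebra K E) (LeavittPathAlgebra K E) :=
  ⟨fun t x y => by
    obtain ⟨a, rfl⟩ := mk_surjective K E x
    obtain ⟨b, rfl⟩ := mk_surjective K E y
    exact congrArg (mk K E) (smul_mul_assoc t a b)⟩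

instance : SMulCommClass K (LeavittPathAlgebra K E) (LeavittPathAlgebra K E) :=
  ⟨fun t x y => by
    obtain ⟨a, rfl⟩ := mk_surjective K E x
    obtain ⟨b, rfl⟩ := mk_surjective K E y
    exact congrArg (mk K E) (mul_smul_comm t a b).symm⟩

end LeavittPathAlgebra

/-!
A *Leavitt family* of a graph `E` in an algebra `A` is a choice of elements of `A` indexed by the
vertices, edges and ghost edges of `E` which satisfies the defining relations of `L_K(E)`; the
homomorphisms `L_K(E) → A` are the Leavitt families of `E` in `A` (`LeavittFamily.lift` and
`LeavittPathAlgebra.algHom_ext`). An isomorphism `L_K(E) ≅ L_K(F)` is therefore the same as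
a mutually inverse way of expressing the generators of either algebra through those of the other
(`LeavittPathAlgebra.bijective_lift`).

For a shift along `θ : s⁻¹(w) → s⁻¹(v)` with new edge `f`, these expressions are

* `f = ∑ θ(g) g*`, the sum being over `g ∈ s⁻¹(w)`, in `L_K(E)` (`LeavittFamily.shift`);
* `θ(g) = f g` for `g ∈ s⁻¹(w)`, in the algebra of the shift (`LeavittFamily.unshift`), where `g`
  is still an edge, because it starts at `w ≠ v`.

They are mutually inverse: `(∑ θ(h) h*) g = θ(g)` by (CK1), and `∑ f g g* = f w = f` by (CK2) at
`w`, which is not a sink. The ghost edges are treated symmetrically, by `f* = ∑ g θ(g)*` and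
`θ(g)* = g* f*`, and the relations (CK1) are checked in the same way. The relation (CK2) at `v`
compares a sum over the edges of `E` emitted by `v` with the same sum over the edges of the shift;
they agree because `f f* = ∑ θ(g) θ(g)*` in both algebras (`DirectedGraph.sum_shift_emitted`).
-/

open DirectedGraph

/-! ### Emitted edges of a shift -/

/-- The form of a sum over the edges of a shift: on the left the edges of `T` which violate `P` are
replaced by the single index `none`, whose summand is the sum of theirs. -/
theorem Finset.sum_option_subtype {α A : Type*} [AddCommMonoid A] {P : α → Prop}
    [DecidablePred P] (S : Finset (Option {a // P a})) (T : Finset α)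
    (hS : ∀ a : {a // P a}, some a ∈ S ↔ (a : α) ∈ T) (H : α → A) (H' : Option {a // P a} → A)
    (hsome : ∀ a, H' (some a) = H a)
    (hnone : none ∈ S → H' none = ∑ a ∈ T with ¬ P a, H a)
    (hP : none ∉ S → ∀ a ∈ T, P a) :
    ∑ f ∈ S, H' f = ∑ a ∈ T, H a := by
  rw [← Finset.sum_filter_add_sum_filter_not T P, ← Finset.sum_subtype_eq_sum_filter, add_comm]
  by_cases h : none ∈ S
  · have : S = Finset.insertNone (T.subtype P) := by
      ext (_ | a) <;> simp [h, hS]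
    rw [this, Finset.sum_insertNone, hnone h]
    simp only [hsome]
  · have : S = (T.subtype P).map Function.Embedding.some := by
      ext (_ | a) <;> simp [h, hS]
    rw [this, Finset.sum_map, Finset.filter_false_of_mem (by simpa using hP h), Finset.sum_empty,
      zero_add]
    exact Finset.sum_congr rfl fun a _ => hsome a

namespace DirectedGraph

variable {E : DirectedGraph.{u, v}} {F : DirectedGraph.{u', v'}}

/-- The inverse of an isomorphism of graphs. -/
def Iso.symm (i : Iso E F) : Iso F E where
  onVertex := i.onVertex.symm
  onEdge := i.onEdge.symm
  source_onEdge e := by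
    rw [Equiv.eq_symm_apply, ← i.source_onEdge, Equiv.apply_symm_apply]
  range_onEdge e := by
    rw [Equiv.eq_symm_apply, ← i.range_onEdge, Equiv.apply_symm_apply]

theorem Iso.image_emitted (i : Iso E F) (x : E.Vertex) :
    i.onEdge '' E.emitted x = F.emitted (i.onVertex x) := by
  ext f
  obtain ⟨e, rfl⟩ := i.onEdge.surjective f
  simp [emitted, i.source_onEdge]

theorem Iso.isSink_iff (i : Iso E F) (x : E.Vertex) : F.IsSink (i.onVertex x) ↔ E.IsSink x := by
  rw [IsSink, IsSink, ← i.image_emitted, Set.image_eq_empty]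

theorem Iso.rowFinite (i : Iso E F) (h : E.RowFinite) : F.RowFinite := fun y => by
  obtain ⟨x, rfl⟩ := i.onVertex.surjective y
  rw [← i.image_emitted]
  exact (h x).image _

variable {v w : E.Vertex} {θ : E.emitted w → E.emitted v}

/-- The new edge of a shift. -/
def newEdge (θ : E.emitted w → E.emitted v) : (E.shift v w θ).Edge := none

/-- The edges of `E` outside the image of `θ` as edges of the shift. -/
def oldEdge (e : {e : E.Edge // ∀ g : E.emitted w, (θ g : E.Edge) ≠ e}) :
    (E.shift v w θ).Edge := some e

theorem newEdge_ne_oldEdge (e : {e : E.Edge // ∀ g : E.emitted w, (θ g : E.Edge) ≠ e}) :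
    newEdge θ ≠ oldEdge e := (Option.some_ne_none e).symm

theorem oldEdge_injective : Function.Injective (oldEdge (θ := θ)) := Option.some_injective _

/-- The edges of `E` emitted by `w` as edges of the shift: they are not among the edges
`θ(g)`, which are emitted by `v ≠ w`. -/
def keep (hvw : v ≠ w) (g : E.emitted w) : (E.shift v w θ).Edge :=
  oldEdge ⟨g, fun h hg => hvw ((θ h).2.symm.trans ((congrArg E.source hg).trans g.2))⟩

theorem keep_injective (hvw : v ≠ w) : Function.Injective (keep (θ := θ) hvw) := fun _ _ h =>
  Subtype.ext (Subtype.mk.inj (oldEdge_injective h))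

/-- An edge of `E` is either one of those that the shift replaces or an edge of the shift. -/
theorem edge_or_exists (θ : E.emitted w → E.emitted v) (e : E.Edge) :
    (∃ g, e = θ g) ∨ ∃ e' : {e : E.Edge // ∀ g : E.emitted w, (θ g : E.Edge) ≠ e}, e = e' := by
  by_cases h : ∃ g, (θ g : E.Edge) = e
  · exact .inl (h.imp fun _ => Eq.symm)
  · exact .inr ⟨⟨e, not_exists.1 h⟩, rfl⟩

theorem shift_rowFinite (hE : E.RowFinite) : (E.shift v w θ).RowFinite := fun x => by
  refine (((hE x).preimage Subtype.val_injective.injOn).image some |>.insert none).subset ?_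
  rintro (_ | e) he
  · exact Set.mem_insert _ _
  · exact Set.mem_insert_of_mem _ ⟨e, he, rfl⟩

/-- A shift has the same sinks: if `v` loses all its edges to the image of `θ`, it still emits the
new edge. -/
theorem shift_isSink_iff (hv : ¬ E.IsSink v) (x : E.Vertex) :
    (E.shift v w θ).IsSink x ↔ E.IsSink x := by
  simp only [IsSink, Set.eq_empty_iff_forall_notMem] at hv ⊢
  constructor
  · intro h e he
    by_cases hθ : ∀ g : E.emitted w, (θ g : E.Edge) ≠ e
    · exact h (some ⟨e, hθ⟩) he
    · push Not at hθ
      obtain ⟨g, rfl⟩ := hθ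
      exact h none ((θ g).2.symm.trans he)
  · rintro h (_ | e) he
    · cases (show v = x from he)
      exact hv h
    · exact h e he

/-- A sum over the edges emitted by a vertex does not change under a shift if the summand of the
new edge is the sum of those of the edges which it replaces. -/
theorem sum_shift_emitted {A : Type*} [AddCommMonoid A] [Fintype (E.emitted w)]
    (hθ : Function.Injective θ) (H : E.Edge → A) (H' : (E.shift v w θ).Edge → A)
    (hsome : ∀ e, H' (some e) = H e) (hnone : H' none = ∑ g, H (θ g)) (x : E.Vertex)
    (hx : (E.emitted x).Finite) (hx' : ((E.shift v w θ).emitted x).Finite) :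
    ∑ f ∈ hx'.toFinset, H' f = ∑ e ∈ hx.toFinset, H e := by
  classical
  refine Finset.sum_option_subtype _ _ (fun e => ?_) H H' hsome (fun h => ?_) (fun h e he => ?_)
  · exact (Set.Finite.mem_toFinset hx').trans (Set.Finite.mem_toFinset hx).symm
  · obtain rfl : v = x := (Set.Finite.mem_toFinset hx').1 h
    rw [hnone]
    refine Finset.sum_bij (fun g _ => (θ g : E.Edge)) ?_ ?_ ?_ (fun _ _ => rfl)
    · intro g _
      simp only [Finset.mem_filter, Set.Finite.mem_toFinset]
      exact ⟨(θ g).2, fun h => h g rfl⟩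
    · intro a _ b _ h
      exact hθ (Subtype.ext h)
    · intro e he
      have := (Finset.mem_filter.1 he).2
      push Not at this
      obtain ⟨g, hg⟩ := this
      exact ⟨g, Finset.mem_univ _, hg⟩
  · rintro g rfl
    exact h ((Set.Finite.mem_toFinset hx').2
      ((θ g).2.symm.trans ((Set.Finite.mem_toFinset hx).1 he)))

end DirectedGraph

/-! ### Leavitt families and the universal property -/

/-- Elements of a ring `A` indexed by the vertices, edges and ghost edges of `E` which satisfy
the defining relations (V), (E1), (E2), (CK1) and (CK2) of the Leavitt path algebra of `E`. As in
`LeavittFree.Rel`, the relation (CK2) is imposed at the vertices emitting finitely many edges. -/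
structure LeavittFamily (E : DirectedGraph.{u, v}) (A : Type*) [NonUnitalRing A] where
  vert : E.Vertex → A
  edge : E.Edge → A
  ghost : E.Edge → A
  vert_same (x) : vert x * vert x = vert x
  vert_ne (x y) : x ≠ y → vert x * vert y = 0
  source_edge (e) : vert (E.source e) * edge e = edge e
  edge_range (e) : edge e * vert (E.range e) = edge e
  range_ghost (e) : vert (E.range e) * ghost e = ghost e
  ghost_source (e) : ghost e * vert (E.source e) = ghost e
  ck1_same (e) : ghost e * edge e = vert (E.range e)
  ck1_ne (e f) : e ≠ f → ghost e * edge f = 0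
  ck2 (x) (hfin : (E.emitted x).Finite) : ¬ E.IsSink x →
    vert x = ∑ e ∈ hfin.toFinset, edge e * ghost e

namespace LeavittFamily

section

variable {E : DirectedGraph.{u, v}} {A : Type*} [NonUnitalRing A] (Φ : LeavittFamily E A)

/-- The value of a Leavitt family on a generator. -/
def onGen : LeavittGen E → A
  | .vertex x => Φ.vert x
  | .edge e => Φ.edge e
  | .ghost e => Φ.ghost e

variable {K : Type k} [Field K] [Module K A] [IsScalarTower K A A] [SMulCommClass K A A]

/-- The homomorphism from the free algebra given by a Leavitt family. -/
noncomputable def liftFree : LeavittFree K E →ₙₐ[K] A :=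
  MonoidAlgebra.liftMagma K (FreeSemigroup.lift Φ.onGen)

theorem liftFree_gen (x : LeavittGen E) : Φ.liftFree (LeavittFree.gen K E x) = Φ.onGen x := by
  simp [liftFree, LeavittFree.gen]

theorem liftFree_vert (x : E.Vertex) : Φ.liftFree (LeavittFree.vert K E x) = Φ.vert x :=
  Φ.liftFree_gen _

theorem liftFree_edge (e : E.Edge) : Φ.liftFree (LeavittFree.edge K E e) = Φ.edge e :=
  Φ.liftFree_gen _

theorem liftFree_ghost (e : E.Edge) : Φ.liftFree (LeavittFree.ghost K E e) = Φ.ghost e :=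
  Φ.liftFree_gen _

theorem liftFree_eq_of_rel {a b : LeavittFree K E} (h : LeavittFree.Rel K E a b) :
    Φ.liftFree a = Φ.liftFree b := by
  induction h with
  | vert_same x => simp only [map_mul, liftFree_vert, Φ.vert_same]
  | vert_ne x y h => simp only [map_mul, liftFree_vert, Φ.vert_ne x y h, map_zero]
  | source_edge e => simp only [map_mul, liftFree_vert, liftFree_edge, Φ.source_edge]
  | edge_range e => simp only [map_mul, liftFree_vert, liftFree_edge, Φ.edge_range]
  | range_ghost e => simp only [map_mul, liftFree_vert, liftFree_ghost, Φ.range_ghost]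
  | ghost_source e => simp only [map_mul, liftFree_vert, liftFree_ghost, Φ.ghost_source]
  | ck1_same e => simp only [map_mul, liftFree_vert, liftFree_edge, liftFree_ghost, Φ.ck1_same]
  | ck1_ne e f h => simp only [map_mul, liftFree_edge, liftFree_ghost, Φ.ck1_ne e f h, map_zero]
  | ck2 x hfin h =>
    simp only [map_sum, map_mul, liftFree_vert, liftFree_edge, liftFree_ghost, Φ.ck2 x hfin h]
  | refl a => rfl
  | symm _ ih => exact ih.symm
  | trans _ _ ih ih' => exact ih.trans ih'
  | add _ _ ih ih' => rw [map_add, map_add, ih, ih']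
  | mul _ _ ih ih' => rw [map_mul, map_mul, ih, ih']
  | smul t _ ih => rw [map_smul, map_smul, ih]

/-- The homomorphism from the Leavitt path algebra given by a Leavitt family. -/
noncomputable def lift : LeavittPathAlgebra K E →ₙₐ[K] A where
  toFun := Quotient.lift Φ.liftFree fun _ _ h => Φ.liftFree_eq_of_rel h
  map_smul' t x := by
    obtain ⟨a, rfl⟩ := LeavittPathAlgebra.mk_surjective K E x
    exact map_smul Φ.liftFree t a
  map_zero' := map_zero Φ.liftFree
  map_add' x y := by
    obtain ⟨a, rfl⟩ := LeavittPathAlgebra.mk_surjective K E x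
    obtain ⟨b, rfl⟩ := LeavittPathAlgebra.mk_surjective K E y
    exact map_add Φ.liftFree a b
  map_mul' x y := by
    obtain ⟨a, rfl⟩ := LeavittPathAlgebra.mk_surjective K E x
    obtain ⟨b, rfl⟩ := LeavittPathAlgebra.mk_surjective K E y
    exact map_mul Φ.liftFree a b

end

end LeavittFamily

namespace LeavittPathAlgebra

variable (K : Type k) [Field K]

/-- The quotient map as a homomorphism of algebras. -/
noncomputable def mkAlgHom (E : DirectedGraph.{u, v}) :
    LeavittFree K E →ₙₐ[K] LeavittPathAlgebra K E where
  toFun := mk K E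
  map_smul' _ _ := rfl
  map_zero' := rfl
  map_add' _ _ := rfl
  map_mul' _ _ := rfl

/-- The Leavitt family of the generators of the Leavitt path algebra. -/
noncomputable def family (E : DirectedGraph.{u, v}) :
    LeavittFamily E (LeavittPathAlgebra K E) where
  vert x := mk K E (LeavittFree.vert K E x)
  edge e := mk K E (LeavittFree.edge K E e)
  ghost e := mk K E (LeavittFree.ghost K E e)
  vert_same x := Quotient.sound (LeavittFree.Rel.vert_same x)
  vert_ne x y h := Quotient.sound (LeavittFree.Rel.vert_ne x y h)
  source_edge e := Quotient.sound (LeavittFree.Rel.source_edge e)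
  edge_range e := Quotient.sound (LeavittFree.Rel.edge_range e)
  range_ghost e := Quotient.sound (LeavittFree.Rel.range_ghost e)
  ghost_source e := Quotient.sound (LeavittFree.Rel.ghost_source e)
  ck1_same e := Quotient.sound (LeavittFree.Rel.ck1_same e)
  ck1_ne e f h := Quotient.sound (LeavittFree.Rel.ck1_ne e f h)
  ck2 x hfin h := (Quotient.sound (LeavittFree.Rel.ck2 x hfin h)).trans
    (map_sum (mkAlgHom K E) (fun e => LeavittFree.edge K E e * LeavittFree.ghost K E e) _)

variable {K} {E : DirectedGraph.{u, v}} {F : DirectedGraph.{u', v'}}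

section

variable {A : Type*} [NonUnitalRing A] [Module K A]

section

variable [IsScalarTower K A A] [SMulCommClass K A A]

theorem lift_vert (Φ : LeavittFamily E A) (x : E.Vertex) :
    Φ.lift ((family K E).vert x) = Φ.vert x := Φ.liftFree_vert x

theorem lift_edge (Φ : LeavittFamily E A) (e : E.Edge) :
    Φ.lift ((family K E).edge e) = Φ.edge e := Φ.liftFree_edge e

theorem lift_ghost (Φ : LeavittFamily E A) (e : E.Edge) :
    Φ.lift ((family K E).ghost e) = Φ.ghost e := Φ.liftFree_ghost e

end

theorem algHom_ext {φ ψ : LeavittPathAlgebra K E →ₙₐ[K] A}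
    (hvert : ∀ x, φ ((family K E).vert x) = ψ ((family K E).vert x))
    (hedge : ∀ e, φ ((family K E).edge e) = ψ ((family K E).edge e))
    (hghost : ∀ e, φ ((family K E).ghost e) = ψ ((family K E).ghost e)) : φ = ψ := by
  have h : φ.comp (mkAlgHom K E) = ψ.comp (mkAlgHom K E) := by
    apply MonoidAlgebra.nonUnitalAlgHom_ext'
    apply FreeSemigroup.hom_ext
    funext x
    cases x with
    | vertex x => exact hvert x
    | edge e => exact hedge e
    | ghost e => exact hghost e
  ext x
  obtain ⟨a, rfl⟩ := mk_surjective K E x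
  exact DFunLike.congr_fun h a

end

/-- Two Leavitt families which express the generators of either of two Leavitt path algebras
through those of the other, in a mutually inverse way, give an isomorphism. -/
theorem bijective_lift (Φ : LeavittFamily E (LeavittPathAlgebra K F))
    (Ψ : LeavittFamily F (LeavittPathAlgebra K E))
    (hvert : ∀ x, Ψ.lift (K := K) (Φ.vert x) = (family K E).vert x)
    (hedge : ∀ e, Ψ.lift (K := K) (Φ.edge e) = (family K E).edge e)
    (hghost : ∀ e, Ψ.lift (K := K) (Φ.ghost e) = (family K E).ghost e)
    (hvert' : ∀ x, Φ.lift (K := K) (Ψ.vert x) = (family K F).vert x)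
    (hedge' : ∀ e, Φ.lift (K := K) (Ψ.edge e) = (family K F).edge e)
    (hghost' : ∀ e, Φ.lift (K := K) (Ψ.ghost e) = (family K F).ghost e) :
    Function.Bijective (Φ.lift (K := K)) := by
  have h : (Ψ.lift (K := K)).comp Φ.lift = NonUnitalAlgHom.id K _ := by
    apply algHom_ext <;> intro x <;>
      simp [lift_vert, lift_edge, lift_ghost, hvert, hedge, hghost]
  have h' : (Φ.lift (K := K)).comp Ψ.lift = NonUnitalAlgHom.id K _ := by
    apply algHom_ext <;> intro x <;>
      simp [lift_vert, lift_edge, lift_ghost, hvert', hedge', hghost']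
  exact Function.bijective_iff_has_inverse.2
    ⟨Ψ.lift, DFunLike.congr_fun h, DFunLike.congr_fun h'⟩

end LeavittPathAlgebra

/-! ### Isomorphic graphs -/

/-- The pullback of a Leavitt family along an isomorphism of graphs. -/
def LeavittFamily.comap {E : DirectedGraph.{u, v}} {F : DirectedGraph.{u', v'}} {A : Type*}
    [NonUnitalRing A] (Φ : LeavittFamily F A) (i : Iso E F) : LeavittFamily E A where
  vert x := Φ.vert (i.onVertex x)
  edge e := Φ.edge (i.onEdge e)
  ghost e := Φ.ghost (i.onEdge e)
  vert_same x := Φ.vert_same _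
  vert_ne x y h := Φ.vert_ne _ _ (i.onVertex.injective.ne h)
  source_edge e := by rw [← i.source_onEdge, Φ.source_edge]
  edge_range e := by rw [← i.range_onEdge, Φ.edge_range]
  range_ghost e := by rw [← i.range_onEdge, Φ.range_ghost]
  ghost_source e := by rw [← i.source_onEdge, Φ.ghost_source]
  ck1_same e := by rw [Φ.ck1_same, i.range_onEdge]
  ck1_ne e f h := Φ.ck1_ne _ _ (i.onEdge.injective.ne h)
  ck2 x hfin h := by
    have hfin' : (F.emitted (i.onVertex x)).Finite := i.image_emitted x ▸ hfin.image _
    rw [Φ.ck2 _ hfin' (by rwa [i.isSink_iff])]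
    symm
    refine Finset.sum_equiv i.onEdge (fun e => ?_) (fun _ _ => rfl)
    rw [Set.Finite.mem_toFinset, Set.Finite.mem_toFinset, ← i.image_emitted,
      i.onEdge.injective.mem_set_image]

theorem LeavittPathAlgebra.exists_bijective_of_iso (K : Type k) [Field K]
    {E : DirectedGraph.{u, v}} {F : DirectedGraph.{u', v'}} (i : Iso E F) :
    ∃ φ : LeavittPathAlgebra K E →ₙₐ[K] LeavittPathAlgebra K F, Function.Bijective φ := by
  refine ⟨((family K F).comap i).lift, bijective_lift _ ((family K E).comap i.symm)
    ?_ ?_ ?_ ?_ ?_ ?_⟩ <;> intro x <;>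
    simp [LeavittFamily.comap, lift_vert, lift_edge, lift_ghost, Iso.symm]

/-! ### The shift -/

namespace LeavittFamily

variable {E : DirectedGraph.{u, v}} {A : Type*} [NonUnitalRing A]

theorem ghost_mul_edge_mul (Φ : LeavittFamily E A) (e : E.Edge) (a : A) :
    Φ.ghost e * (Φ.edge e * a) = Φ.vert (E.range e) * a := by
  rw [← mul_assoc, Φ.ck1_same]

theorem ghost_mul_edge_mul_of_ne (Φ : LeavittFamily E A) {e f : E.Edge} (h : e ≠ f) (a : A) :
    Φ.ghost e * (Φ.edge f * a) = 0 := by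
  rw [← mul_assoc, Φ.ck1_ne e f h, zero_mul]

variable {v w : E.Vertex} {θ : E.emitted w → E.emitted v}

section

variable [Fintype (E.emitted w)]

/-- The relation (CK2) at `w` as a sum over a type. -/
theorem sum_edge_mul_ghost (Φ : LeavittFamily E A) (hw : ¬ E.IsSink w) :
    ∑ g : E.emitted w, Φ.edge g * Φ.ghost g = Φ.vert w := by
  rw [Φ.ck2 w (Set.toFinite _) hw]
  exact (Finset.sum_subtype _ (fun e => Set.Finite.mem_toFinset _)
    (fun e => Φ.edge e * Φ.ghost e)).symm

/-- The element `∑ θ(g) g*`, the sum being over `g ∈ s⁻¹(w)`: the new edge of the shift. -/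
def shiftEdge (Φ : LeavittFamily E A) (θ : E.emitted w → E.emitted v) : A :=
  ∑ g, Φ.edge (θ g) * Φ.ghost g

/-- The element `∑ g θ(g)*`, the sum being over `g ∈ s⁻¹(w)`: the new ghost edge of the shift. -/
def shiftGhost (Φ : LeavittFamily E A) (θ : E.emitted w → E.emitted v) : A :=
  ∑ g : E.emitted w, Φ.edge g * Φ.ghost (θ g)

variable (Φ : LeavittFamily E A)

theorem vert_mul_shiftEdge : Φ.vert v * Φ.shiftEdge θ = Φ.shiftEdge θ := by
  rw [shiftEdge, Finset.mul_sum]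
  refine Finset.sum_congr rfl fun g _ => ?_
  have := Φ.source_edge (θ g)
  rw [(θ g).2] at this
  rw [← mul_assoc, this]

theorem shiftEdge_mul_vert : Φ.shiftEdge θ * Φ.vert w = Φ.shiftEdge θ := by
  rw [shiftEdge, Finset.sum_mul]
  refine Finset.sum_congr rfl fun g _ => ?_
  have := Φ.ghost_source g
  rw [g.2] at this
  rw [mul_assoc, this]

theorem vert_mul_shiftGhost : Φ.vert w * Φ.shiftGhost θ = Φ.shiftGhost θ := by
  rw [shiftGhost, Finset.mul_sum]
  refine Finset.sum_congr rfl fun g _ => ?_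
  have := Φ.source_edge g
  rw [g.2] at this
  rw [← mul_assoc, this]

theorem shiftGhost_mul_vert : Φ.shiftGhost θ * Φ.vert v = Φ.shiftGhost θ := by
  rw [shiftGhost, Finset.sum_mul]
  refine Finset.sum_congr rfl fun g _ => ?_
  have := Φ.ghost_source (θ g)
  rw [(θ g).2] at this
  rw [mul_assoc, this]

theorem ghost_mul_shiftEdge_of_ne {e : E.Edge} (he : ∀ g : E.emitted w, (θ g : E.Edge) ≠ e) :
    Φ.ghost e * Φ.shiftEdge θ = 0 := by
  rw [shiftEdge, Finset.mul_sum]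
  exact Finset.sum_eq_zero fun g _ => Φ.ghost_mul_edge_mul_of_ne (he g).symm _

theorem shiftGhost_mul_edge_of_ne {e : E.Edge} (he : ∀ g : E.emitted w, (θ g : E.Edge) ≠ e) :
    Φ.shiftGhost θ * Φ.edge e = 0 := by
  rw [shiftGhost, Finset.sum_mul]
  exact Finset.sum_eq_zero fun g _ => by rw [mul_assoc, Φ.ck1_ne _ _ (he g), mul_zero]

theorem shiftEdge_mul_edge (hr : ∀ g : E.emitted w, E.range (θ g) = E.range g)
    (g : E.emitted w) : Φ.shiftEdge θ * Φ.edge g = Φ.edge (θ g) := by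
  rw [shiftEdge, Finset.sum_mul, Finset.sum_eq_single g]
  · rw [mul_assoc, Φ.ck1_same, ← hr, Φ.edge_range]
  · intro h _ hne
    rw [mul_assoc, Φ.ck1_ne _ _ (Subtype.val_injective.ne hne), mul_zero]
  · simp

theorem ghost_mul_shiftGhost (hr : ∀ g : E.emitted w, E.range (θ g) = E.range g)
    (g : E.emitted w) : Φ.ghost g * Φ.shiftGhost θ = Φ.ghost (θ g) := by
  rw [shiftGhost, Finset.mul_sum, Finset.sum_eq_single g]
  · rw [ghost_mul_edge_mul, ← hr, Φ.range_ghost]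
  · intro h _ hne
    exact Φ.ghost_mul_edge_mul_of_ne (Subtype.val_injective.ne hne.symm) _
  · simp

theorem shiftEdge_mul_shiftGhost (hr : ∀ g : E.emitted w, E.range (θ g) = E.range g) :
    Φ.shiftEdge θ * Φ.shiftGhost θ = ∑ g, Φ.edge (θ g) * Φ.ghost (θ g) := by
  conv_lhs => rw [shiftEdge, Finset.sum_mul]
  exact Finset.sum_congr rfl fun g _ => by rw [mul_assoc, Φ.ghost_mul_shiftGhost hr]

theorem shiftGhost_mul_shiftEdge (hθ : Function.Injective θ) (hw : ¬ E.IsSink w)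
    (hr : ∀ g : E.emitted w, E.range (θ g) = E.range g) :
    Φ.shiftGhost θ * Φ.shiftEdge θ = Φ.vert w := by
  rw [← Φ.sum_edge_mul_ghost hw, shiftGhost, Finset.sum_mul]
  refine Finset.sum_congr rfl fun g _ => ?_
  rw [shiftEdge, Finset.mul_sum, Finset.sum_eq_single g]
  · rw [mul_assoc, ghost_mul_edge_mul, hr, Φ.range_ghost]
  · intro h _ hne
    rw [mul_assoc, Φ.ghost_mul_edge_mul_of_ne (Subtype.val_injective.ne (hθ.ne hne.symm)),
      mul_zero]
  · simp

/-- The Leavitt family of a shift given by a Leavitt family of `E`: the new edge is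
`∑ θ(g) g*`. -/
def shift (hE : E.RowFinite) (hv : ¬ E.IsSink v) (hw : ¬ E.IsSink w) (hθ : Function.Injective θ)
    (hr : ∀ g : E.emitted w, E.range (θ g) = E.range g) :
    LeavittFamily (E.shift v w θ) A where
  vert := Φ.vert
  edge f := f.elim (Φ.shiftEdge θ) fun e => Φ.edge e
  ghost f := f.elim (Φ.shiftGhost θ) fun e => Φ.ghost e
  vert_same := Φ.vert_same
  vert_ne := Φ.vert_ne
  source_edge
    | none => Φ.vert_mul_shiftEdge
    | some e => Φ.source_edge e
  edge_range
    | none => Φ.shiftEdge_mul_vert (w := w)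
    | some e => Φ.edge_range e
  range_ghost
    | none => Φ.vert_mul_shiftGhost (w := w)
    | some e => Φ.range_ghost e
  ghost_source
    | none => Φ.shiftGhost_mul_vert
    | some e => Φ.ghost_source e
  ck1_same
    | none => Φ.shiftGhost_mul_shiftEdge hθ hw hr
    | some e => Φ.ck1_same e
  ck1_ne
    | none, none, h => (h rfl).elim
    | none, some e, _ => Φ.shiftGhost_mul_edge_of_ne e.2
    | some e, none, _ => Φ.ghost_mul_shiftEdge_of_ne e.2
    | some e, some f, h => Φ.ck1_ne e f fun h' => h (congrArg some (Subtype.ext h'))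
  ck2 x hfin hx :=
    (Φ.ck2 x (hE x) ((shift_isSink_iff hv x).not.1 hx)).trans
      (sum_shift_emitted hθ (fun e => Φ.edge e * Φ.ghost e) _ (fun _ => rfl)
        (Φ.shiftEdge_mul_shiftGhost hr) x (hE x) hfin).symm

end

section

variable (Ψ : LeavittFamily (E.shift v w θ) A) (hvw : v ≠ w)

open Classical in
/-- The edges of `E` in terms of a Leavitt family of the shift: `θ(g)` is the product of the new
edge and `g`, and the other edges are edges of the shift. -/
noncomputable def unshiftEdge (e : E.Edge) : A :=
  if h : ∃ g, (θ g : E.Edge) = e then Ψ.edge (newEdge θ) * Ψ.edge (keep hvw h.choose)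
  else Ψ.edge (oldEdge ⟨e, not_exists.1 h⟩)

open Classical in
/-- The ghost edges of `E` in terms of a Leavitt family of the shift, with `θ(g)* = g* f*` for the
new edge `f`. -/
noncomputable def unshiftGhost (e : E.Edge) : A :=
  if h : ∃ g, (θ g : E.Edge) = e then Ψ.ghost (keep hvw h.choose) * Ψ.ghost (newEdge θ)
  else Ψ.ghost (oldEdge ⟨e, not_exists.1 h⟩)

theorem unshiftEdge_apply (hθ : Function.Injective θ) (g : E.emitted w) :
    Ψ.unshiftEdge hvw (θ g) = Ψ.edge (newEdge θ) * Ψ.edge (keep hvw g) := by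
  have h : ∃ g', (θ g' : E.Edge) = θ g := ⟨g, rfl⟩
  rw [unshiftEdge, dif_pos h, hθ (Subtype.ext h.choose_spec)]

theorem unshiftGhost_apply (hθ : Function.Injective θ) (g : E.emitted w) :
    Ψ.unshiftGhost hvw (θ g) = Ψ.ghost (keep hvw g) * Ψ.ghost (newEdge θ) := by
  have h : ∃ g', (θ g' : E.Edge) = θ g := ⟨g, rfl⟩
  rw [unshiftGhost, dif_pos h, hθ (Subtype.ext h.choose_spec)]

theorem unshiftEdge_of_ne (e : {e : E.Edge // ∀ g : E.emitted w, (θ g : E.Edge) ≠ e}) :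
    Ψ.unshiftEdge hvw e = Ψ.edge (oldEdge e) :=
  dif_neg (not_exists.2 e.2)

theorem unshiftGhost_of_ne (e : {e : E.Edge // ∀ g : E.emitted w, (θ g : E.Edge) ≠ e}) :
    Ψ.unshiftGhost hvw e = Ψ.ghost (oldEdge e) :=
  dif_neg (not_exists.2 e.2)

theorem edge_newEdge_mul_vert : Ψ.edge (newEdge θ) * Ψ.vert w = Ψ.edge (newEdge θ) :=
  Ψ.edge_range (newEdge θ)

theorem vert_mul_edge_keep (g : E.emitted w) :
    Ψ.vert w * Ψ.edge (keep hvw g) = Ψ.edge (keep hvw g) :=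
  (congrArg (fun x => Ψ.vert x * Ψ.edge (keep hvw g)) g.2.symm).trans
    (Ψ.source_edge (keep hvw g))

theorem ghost_newEdge_mul_edge_newEdge_mul_edge_keep (g : E.emitted w) :
    Ψ.ghost (newEdge θ) * (Ψ.edge (newEdge θ) * Ψ.edge (keep hvw g)) = Ψ.edge (keep hvw g) :=
  (Ψ.ghost_mul_edge_mul (newEdge θ) _).trans (Ψ.vert_mul_edge_keep hvw g)

variable [Fintype (E.emitted w)]

/-- The relation (CK2) of the shift at `w`, which emits there the same edges as in `E`. -/
theorem sum_edge_keep_mul_ghost_keep (hE : E.RowFinite) (hv : ¬ E.IsSink v)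
    (hw : ¬ E.IsSink w) :
    ∑ g : E.emitted w, Ψ.edge (keep hvw g) * Ψ.ghost (keep hvw g) = Ψ.vert w := by
  refine Eq.trans ?_ (Ψ.ck2 w (shift_rowFinite hE w) ((shift_isSink_iff hv w).not.2 hw)).symm
  refine Finset.sum_bij (fun g _ => keep hvw g) (fun g _ => ?_)
    (fun _ _ _ _ h => keep_injective hvw h) ?_ (fun _ _ => rfl)
  · exact (Set.Finite.mem_toFinset _).2 g.2
  · intro f hf
    have hf' := (Set.Finite.mem_toFinset _).1 hf
    obtain _ | e := f
    · exact (hvw hf').elim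
    · exact ⟨⟨e, hf'⟩, Finset.mem_univ _, rfl⟩

/-- As `∑ g g* = w`, the new edge `f` satisfies `f f* = ∑ f g g* f* = ∑ θ(g) θ(g)*`. -/
theorem edge_newEdge_mul_ghost_newEdge (hE : E.RowFinite) (hv : ¬ E.IsSink v) (hw : ¬ E.IsSink w)
    (hθ : Function.Injective θ) :
    Ψ.edge (newEdge θ) * Ψ.ghost (newEdge θ) =
      ∑ g, Ψ.unshiftEdge hvw (θ g) * Ψ.unshiftGhost hvw (θ g) := by
  have h : ∀ g, Ψ.unshiftEdge hvw (θ g) * Ψ.unshiftGhost hvw (θ g) =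
      Ψ.edge (newEdge θ) * (Ψ.edge (keep hvw g) * Ψ.ghost (keep hvw g)) *
        Ψ.ghost (newEdge θ) := fun g => by
    rw [Ψ.unshiftEdge_apply hvw hθ, Ψ.unshiftGhost_apply hvw hθ]
    simp only [mul_assoc]
  simp only [h]
  rw [← Finset.sum_mul, ← Finset.mul_sum, Ψ.sum_edge_keep_mul_ghost_keep hvw hE hv hw,
    Ψ.edge_newEdge_mul_vert]

/-- The Leavitt family of `E` given by a Leavitt family of a shift: the edge `θ(g)` is the product
of the new edge and `g`. -/
noncomputable def unshift (hE : E.RowFinite) (hv : ¬ E.IsSink v) (hw : ¬ E.IsSink w)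
    (hθ : Function.Injective θ) (hr : ∀ g : E.emitted w, E.range (θ g) = E.range g) :
    LeavittFamily E A where
  vert := Ψ.vert
  edge := Ψ.unshiftEdge hvw
  ghost := Ψ.unshiftGhost hvw
  vert_same := Ψ.vert_same
  vert_ne := Ψ.vert_ne
  source_edge e := by
    obtain ⟨g, rfl⟩ | ⟨e, rfl⟩ := edge_or_exists θ e
    · rw [Ψ.unshiftEdge_apply hvw hθ, (θ g).2, ← mul_assoc]
      exact congrArg (· * _) (Ψ.source_edge (newEdge θ))
    · rw [unshiftEdge_of_ne]
      exact Ψ.source_edge (oldEdge e)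
  edge_range e := by
    obtain ⟨g, rfl⟩ | ⟨e, rfl⟩ := edge_or_exists θ e
    · rw [Ψ.unshiftEdge_apply hvw hθ, hr, mul_assoc]
      exact congrArg (_ * ·) (Ψ.edge_range (keep hvw g))
    · rw [unshiftEdge_of_ne]
      exact Ψ.edge_range (oldEdge e)
  range_ghost e := by
    obtain ⟨g, rfl⟩ | ⟨e, rfl⟩ := edge_or_exists θ e
    · rw [Ψ.unshiftGhost_apply hvw hθ, hr, ← mul_assoc]
      exact congrArg (· * _) (Ψ.range_ghost (keep hvw g))
    · rw [unshiftGhost_of_ne]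
      exact Ψ.range_ghost (oldEdge e)
  ghost_source e := by
    obtain ⟨g, rfl⟩ | ⟨e, rfl⟩ := edge_or_exists θ e
    · rw [Ψ.unshiftGhost_apply hvw hθ, (θ g).2, mul_assoc]
      exact congrArg (_ * ·) (Ψ.ghost_source (newEdge θ))
    · rw [unshiftGhost_of_ne]
      exact Ψ.ghost_source (oldEdge e)
  ck1_same e := by
    obtain ⟨g, rfl⟩ | ⟨e, rfl⟩ := edge_or_exists θ e
    · rw [Ψ.unshiftEdge_apply hvw hθ, Ψ.unshiftGhost_apply hvw hθ, hr, mul_assoc,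
        Ψ.ghost_newEdge_mul_edge_newEdge_mul_edge_keep]
      exact Ψ.ck1_same (keep hvw g)
    · rw [unshiftEdge_of_ne, unshiftGhost_of_ne]
      exact Ψ.ck1_same (oldEdge e)
  ck1_ne e f h := by
    obtain ⟨g, rfl⟩ | ⟨e, rfl⟩ := edge_or_exists θ e <;>
      obtain ⟨g', rfl⟩ | ⟨f, rfl⟩ := edge_or_exists θ f
    · rw [Ψ.unshiftEdge_apply hvw hθ, Ψ.unshiftGhost_apply hvw hθ, mul_assoc,
        Ψ.ghost_newEdge_mul_edge_newEdge_mul_edge_keep]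
      refine Ψ.ck1_ne _ _ ((keep_injective hvw).ne ?_)
      rintro rfl
      exact h rfl
    · rw [Ψ.unshiftGhost_apply hvw hθ, unshiftEdge_of_ne, mul_assoc,
        Ψ.ck1_ne _ _ (newEdge_ne_oldEdge f), mul_zero]
    · rw [Ψ.unshiftEdge_apply hvw hθ, unshiftGhost_of_ne]
      exact Ψ.ghost_mul_edge_mul_of_ne (newEdge_ne_oldEdge e).symm _
    · rw [unshiftEdge_of_ne, unshiftGhost_of_ne]
      refine Ψ.ck1_ne _ _ fun h' => h ?_
      rw [oldEdge_injective h']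
  ck2 x hfin hx :=
    (Ψ.ck2 x (shift_rowFinite hE x) ((shift_isSink_iff hv x).not.2 hx)).trans
      (sum_shift_emitted hθ (fun e => Ψ.unshiftEdge hvw e * Ψ.unshiftGhost hvw e) _
        (fun e => by rw [unshiftEdge_of_ne, unshiftGhost_of_ne]; rfl)
        (Ψ.edge_newEdge_mul_ghost_newEdge hvw hE hv hw hθ) x hfin (shift_rowFinite hE x))

end

end LeavittFamily

/-! ### Invariance under shift moves -/

theorem LeavittPathAlgebra.exists_bijective_shift (K : Type k) [Field K]
    {E : DirectedGraph.{u, v}} (hE : E.RowFinite) {v w : E.Vertex}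
    {θ : E.emitted w → E.emitted v} (hvw : v ≠ w) (hv : ¬ E.IsSink v) (hw : ¬ E.IsSink w)
    (hθ : Function.Injective θ) (hr : ∀ g : E.emitted w, E.range (θ g) = E.range g) :
    ∃ φ : LeavittPathAlgebra K E →ₙₐ[K] LeavittPathAlgebra K (E.shift v w θ),
      Function.Bijective φ := by
  have : Fintype (E.emitted w) := (hE w).fintype
  let Φ := family K E
  let Ψ := family K (E.shift v w θ)
  let Φ' := Φ.shift hE hv hw hθ hr
  let Ψ' := Ψ.unshift hvw hE hv hw hθ hr
  have hedge (f) : Φ'.lift (K := K) (Ψ.edge f) = Φ'.edge f := lift_edge Φ' f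
  have hghost (f) : Φ'.lift (K := K) (Ψ.ghost f) = Φ'.ghost f := lift_ghost Φ' f
  have hedge' (e) : Ψ'.lift (K := K) (Φ.edge e) = Ψ.unshiftEdge hvw e := lift_edge Ψ' e
  have hghost' (e) : Ψ'.lift (K := K) (Φ.ghost e) = Ψ.unshiftGhost hvw e := lift_ghost Ψ' e
  have hedge_keep (g : E.emitted w) : Ψ.unshiftEdge hvw g = Ψ.edge (keep hvw g) :=
    Ψ.unshiftEdge_of_ne hvw ⟨g, _⟩
  have hghost_keep (g : E.emitted w) : Ψ.unshiftGhost hvw g = Ψ.ghost (keep hvw g) :=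
    Ψ.unshiftGhost_of_ne hvw ⟨g, _⟩
  refine ⟨Ψ'.lift, bijective_lift Ψ' Φ' (lift_vert Φ') (fun e => ?_) (fun e => ?_)
    (lift_vert Ψ') ?_ ?_⟩
  · change Φ'.lift (Ψ.unshiftEdge hvw e) = Φ.edge e
    obtain ⟨g, rfl⟩ | ⟨e, rfl⟩ := edge_or_exists θ e
    · rw [Ψ.unshiftEdge_apply hvw hθ, map_mul, hedge, hedge]
      exact Φ.shiftEdge_mul_edge hr g
    · rw [Ψ.unshiftEdge_of_ne, hedge]
      rfl
  · change Φ'.lift (Ψ.unshiftGhost hvw e) = Φ.ghost e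
    obtain ⟨g, rfl⟩ | ⟨e, rfl⟩ := edge_or_exists θ e
    · rw [Ψ.unshiftGhost_apply hvw hθ, map_mul, hghost, hghost]
      exact Φ.ghost_mul_shiftGhost hr g
    · rw [Ψ.unshiftGhost_of_ne, hghost]
      rfl
  · rintro (_ | e)
    -- The new edge `f` goes to `∑ θ(g) g*` and back to `∑ f g g* = f w = f`.
    · change Ψ'.lift (Φ.shiftEdge θ) = Ψ.edge (newEdge θ)
      simp only [LeavittFamily.shiftEdge, map_sum, map_mul, hedge', hghost',
        Ψ.unshiftEdge_apply hvw hθ, hghost_keep, mul_assoc]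
      rw [← Finset.mul_sum, Ψ.sum_edge_keep_mul_ghost_keep hvw hE hv hw]
      exact Ψ.edge_newEdge_mul_vert
    · exact (hedge' e).trans (Ψ.unshiftEdge_of_ne hvw e)
  · rintro (_ | e)
    · change Ψ'.lift (Φ.shiftGhost θ) = Ψ.ghost (newEdge θ)
      simp only [LeavittFamily.shiftGhost, map_sum, map_mul, hedge', hghost',
        Ψ.unshiftGhost_apply hvw hθ, hedge_keep, ← mul_assoc]
      rw [← Finset.sum_mul, Ψ.sum_edge_keep_mul_ghost_keep hvw hE hv hw]
      exact Ψ.range_ghost (newEdge θ)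
    · exact (hghost' e).trans (Ψ.unshiftGhost_of_ne hvw e)

theorem DirectedGraph.IsShiftMove.rowFinite {E F : DirectedGraph.{u, v}} (h : E.IsShiftMove F)
    (hE : E.RowFinite) : F.RowFinite := by
  obtain ⟨v, w, θ, -, -, -, -, -, ⟨i⟩⟩ := h
  exact i.rowFinite (shift_rowFinite hE)

theorem LeavittPathAlgebra.exists_bijective_of_isShiftMove (K : Type k) [Field K]
    {E F : DirectedGraph.{u, v}} (h : E.IsShiftMove F) (hE : E.RowFinite) :
    ∃ φ : LeavittPathAlgebra K E →ₙₐ[K] LeavittPathAlgebra K F, Function.Bijective φ := by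
  obtain ⟨v, w, θ, hvw, hv, hw, hθ, hr, ⟨i⟩⟩ := h
  obtain ⟨φ, hφ⟩ := exists_bijective_shift K hE hvw hv hw hθ hr
  obtain ⟨ψ, hψ⟩ := exists_bijective_of_iso K i
  exact ⟨ψ.comp φ, hψ.comp hφ⟩

theorem mainTheorem4 (K : Type k) [Field K] (E : DirectedGraph.{u, v})
    (F : DirectedGraph.{u', v'}) (hE : E.RowFinite) (hF : E.ObtainedByShiftMoves F) :
    ∃ φ : LeavittPathAlgebra K E →ₙₐ[K] LeavittPathAlgebra K F, Function.Bijective φ := by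
  obtain ⟨G, hG, ⟨i⟩⟩ := hF
  -- Row-finiteness is carried along, as it is needed for the next move.
  have key : G.RowFinite ∧ ∃ φ : LeavittPathAlgebra K E →ₙₐ[K] LeavittPathAlgebra K G,
      Function.Bijective φ := by
    clear i
    induction hG with
    | refl => exact ⟨hE, NonUnitalAlgHom.id K _, Function.bijective_id⟩
    | tail _ h ih =>
      obtain ⟨hrow, φ, hφ⟩ := ih
      obtain ⟨ψ, hψ⟩ := LeavittPathAlgebra.exists_bijective_of_isShiftMove K h hrow
      exact ⟨h.rowFinite hrow, ψ.comp φ, hψ.comp hφ⟩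
  obtain ⟨-, φ, hφ⟩ := key
  obtain ⟨ψ, hψ⟩ := LeavittPathAlgebra.exists_bijective_of_iso K i
  exact ⟨ψ.comp φ, hψ.comp hφ⟩
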